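/- Let $\Gamma_1$ be the graph obtained from an equilateral triangle by joining the midpoints of its sides: its vertices are the three corners and the three midpoints, and it has nine edges. Label the six boundary edges $a,b,a,b,a,b$ in counterclockwise cyclic order, starting with the label $a$ on the edge that goes down from the top corner to the midpoint of the left side, and label the three edges joining midpoints by $c$. For $n\ge 1$, partition an equilateral triangle into four smaller equilateral triangles and place a translated copy of the labelled graph $\Gamma_n$ in each of the three corner triangles, identifying coinciding corners; the resulting labelled graph is $\Gamma_{n+1}$ (the Sierpiński graphs with the rotation-invariant labelling). The corners of the big triangle are called the outmost vertices of $\Gamma_n$. Give each edge the weight named by its label, where $a,b,c$ are formal variables (or arbitrary elements of a commutative semiring), and let the weight of a subgraph be the product of the weights of its edges. A spanning $k$-forest of $\Gamma_n$ is an acyclic subgraph with exactly $k$ connected components that contains all vertices of $\Gamma_n$. For $n\geq 1$ let - $T_n=T_n(a,b,c)$ be the sum of the weights of all spanning trees of $\Gamma_n$; - $S_n=S_n(a,b,c)$ be the sum of the weights of all spanning $2$-forests of $\Gamma_n$ in which two fixed outmost vertices lie in the same component and the third outmost vertex lies in the other component; - $Q_n=Q_n(a,b,c)$ be the sum of the weights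 of all spanning $3$-forests of $\Gamma_n$ in which the three outmost vertices lie in three different components. Then $S_n$ does not depend on the choice of the two outmost vertices, and for every $n\ge 1$ $$T_{n+1}=6T_n^2S_n,\qquad S_{n+1}=7T_nS_n^2+T_n^2Q_n,\qquad Q_{n+1}=12T_nS_nQ_n+14S_n^3,$$ with initial conditions $$T_1=3(a+b)(ab+ac+bc)^2,\qquad S_1=(a+b)(a+b+3c)(ab+ac+bc),\qquad Q_1=(a+b)(a+b+3c)^2.$$ -/

import Mathlib

namespace SierpinskiTrees

/-- The three edge labels. -/
inductive Label
  | a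
  | b
  | c

/-- Translation of a lattice point. The pair `(i, j)` stands for the point
`i • (1, 0) + j • (1/2, √3/2)` of the triangular lattice, so that `(0, 0)` is the left corner,
`(2 ^ n, 0)` the right corner and `(0, 2 ^ n)` the top corner of a triangle of side `2 ^ n`. -/
def shift (d p : ℕ × ℕ) : ℕ × ℕ := (d.1 + p.1, d.2 + p.2)

/-- The vertices of the `n`-th Sierpiński graph: three translated copies of the preceding vertex
set, placed in the corners of a triangle of twice the side. Level `0` is a single triangle;
level `1` consists of the three corners and the three midpoints of the sides. -/
def vertices : ℕ → Finset (ℕ × ℕ)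
  | 0 => {(0, 0), (1, 0), (0, 1)}
  | n + 1 => vertices n ∪ (vertices n).image (shift (2 ^ n, 0)) ∪
      (vertices n).image (shift (0, 2 ^ n))

/-- The edges of the first graph carrying a given label: along the boundary the labels
`a, b, a, b, a, b` alternate, and the three edges joining midpoints of sides carry `c`. -/
def baseEdges : Label → Finset (Sym2 (ℕ × ℕ))
  | .a => {s((0, 2), (0, 1)), s((0, 0), (1, 0)), s((2, 0), (1, 1))}
  | .b => {s((0, 1), (0, 0)), s((1, 0), (2, 0)), s((1, 1), (0, 2))}
  | .c => {s((0, 1), (1, 0)), s((1, 0), (1, 1)), s((1, 1), (0, 1))}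

/-- The edges of the `n`-th Sierpiński graph carrying the label `x` in the rotation-invariant
labelling, for `n ≥ 1`: three translated copies of the preceding labelled graph. The labelling
starts at level `1`; nothing is labelled at level `0`. -/
def edges (x : Label) : ℕ → Finset (Sym2 (ℕ × ℕ))
  | 0 => ∅
  | 1 => baseEdges x
  | n + 2 => edges x (n + 1) ∪ (edges x (n + 1)).image (Sym2.map (shift (2 ^ (n + 1), 0))) ∪
      (edges x (n + 1)).image (Sym2.map (shift (0, 2 ^ (n + 1))))

/-- The vertex type of the `n`-th Sierpiński graph. -/
abbrev Vert (n : ℕ) : Type := {p : ℕ × ℕ // p ∈ vertices n}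

/-- The `n`-th Sierpiński graph (`n ≥ 1`). -/
def graph (n : ℕ) : SimpleGraph (Vert n) :=
  SimpleGraph.fromEdgeSet {e | ∃ x : Label, e.map Subtype.val ∈ edges x n}

/-- The weight of an edge: the value given to its label. -/
def edgeWeight {R : Type*} (a b c : R) (n : ℕ) (e : Sym2 (Vert n)) : R :=
  if e.map Subtype.val ∈ edges .a n then a
  else if e.map Subtype.val ∈ edges .b n then b
  else c

/-- The coordinates of the three outmost vertices. -/
def cornerPoint (n : ℕ) : Fin 3 → ℕ × ℕ
  | 0 => (0, 0)
  | 1 => (2 ^ n, 0)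
  | 2 => (0, 2 ^ n)

theorem cornerPoint_mem (n : ℕ) (i : Fin 3) : cornerPoint n i ∈ vertices n := by
  induction n with
  | zero => fin_cases i <;> decide
  | succ n ih =>
    simp only [vertices, Finset.mem_union, Finset.mem_image]
    fin_cases i
    · exact Or.inl (Or.inl ih)
    · exact Or.inl (Or.inr ⟨_, ih, by simp [cornerPoint, shift, pow_succ, mul_two]⟩)
    · exact Or.inr ⟨_, ih, by simp [cornerPoint, shift, pow_succ, mul_two]⟩

/-- The three outmost vertices of the `n`-th graph. -/
def corner (n : ℕ) (i : Fin 3) : Vert n := ⟨cornerPoint n i, cornerPoint_mem n i⟩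

/-- A graph on `V` which is a forest with exactly `k` connected components. -/
def IsForestWith {V : Type*} (k : ℕ) (H : SimpleGraph V) : Prop :=
  H.IsAcyclic ∧ Nat.card H.ConnectedComponent = k

open Classical in
/-- The weighted generating function of the spanning subgraphs of `G` having the property `P`.
A spanning subgraph is a graph `H ≤ G` on the same vertex type; its weight is the product of the
weights of its edges. -/
noncomputable def genFun {V R : Type*} [Fintype V] [CommSemiring R] (G : SimpleGraph V)
    (w : Sym2 V → R) (P : SimpleGraph V → Prop) : R :=
  ∑ H : SimpleGraph V with H ≤ G ∧ P H, ∏ e ∈ H.edgeFinset, w e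

/-- Weighted generating function of the spanning trees of the `n`-th graph. -/
noncomputable def T {R : Type*} [CommSemiring R] (a b c : R) (n : ℕ) : R :=
  genFun (graph n) (edgeWeight a b c n) fun H => H.IsTree

/-- Weighted generating function of the spanning `2`-forests of the `n`-th graph in which the two
outmost vertices other than `corner n i` lie in the same component and `corner n i` lies in the
other one. -/
noncomputable def S {R : Type*} [CommSemiring R] (a b c : R) (i : Fin 3) (n : ℕ) : R :=
  genFun (graph n) (edgeWeight a b c n) fun H => IsForestWith 2 H ∧
    H.Reachable (corner n (i + 1)) (corner n (i + 2)) ∧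
    ¬ H.Reachable (corner n i) (corner n (i + 1))

/-- Weighted generating function of the spanning `3`-forests of the `n`-th graph in which the three
outmost vertices lie in three different components. -/
noncomputable def Q {R : Type*} [CommSemiring R] (a b c : R) (n : ℕ) : R :=
  genFun (graph n) (edgeWeight a b c n) fun H => IsForestWith 3 H ∧
    ∀ i j : Fin 3, i ≠ j → ¬ H.Reachable (corner n i) (corner n j)

end SierpinskiTrees

/-! A spanning forest of a glued graph is the same as a triple of spanning forests of its three
copies, because the copies share no edges and so both the subgraph and its weight split. What a copy
contributes to the connectivity of the whole is only the partition of its three corners into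
components: one of five `State`s. If every component meets a corner, the states of the copies
determine the state of the whole, so each generating function at the next level is a sum over
admissible triples of states of products of generating functions of the copies
(`IsGluing.genFun_eq`).

Admissibility is controlled by counting. Always |V| ≤ edges + components, with equality exactly for
forests. Gluing three copies at three junctions loses three vertices, so for forests the block
numbers of the copies add up to the block number of the whole plus 3. Hence T needs block numbers
1+1+2, S needs 1+2+2 or 1+1+3, and Q needs 1+2+3 or 2+2+2. Enumerating the triples with the right
connectivity gives 6, 7+1 and 12+14 of them, which are the coefficients of the recursion.

Γ₁ is itself a gluing of three single triangles, with differently placed labels, so the same sums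
give the initial values. That S does not depend on the chosen corner needs no symmetry of the
graphs: it holds for the explicit S₁, and the recursion preserves it. -/

namespace SierpinskiTrees
open SimpleGraph

/-! ### Forests characterised by counting edges and components. -/

section Counting

variable {V : Type*} [Finite V]

/-- A connected graph on m vertices has at least m - 1 edges; sum this over the components, whose
edge sets are disjoint. -/
theorem card_le_card_edgeSet_add_card_connectedComponent (H : SimpleGraph V) :
    Nat.card V ≤ Nat.card H.edgeSet + Nat.card H.ConnectedComponent := by
  classical
  have := Fintype.ofFinite V
  have hV : Nat.card V = ∑ c : H.ConnectedComponent, Nat.card c.supp := by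
    rw [← Nat.card_sigma]
    refine Nat.card_congr ⟨fun v => ⟨H.connectedComponentMk v, v, rfl⟩, fun x => x.2.1,
      fun v => rfl, ?_⟩
    rintro ⟨c, v, hv⟩
    obtain rfl : H.connectedComponentMk v = c := hv
    rfl
  have hE : ∑ c : H.ConnectedComponent, Nat.card c.toSimpleGraph.edgeSet ≤
      Nat.card H.edgeSet := by
    rw [← Nat.card_sigma]
    refine Nat.card_le_card_of_injective
      (fun x => ⟨x.2.1.map Subtype.val, ?_⟩) ?_
    · obtain ⟨c, ⟨e, he⟩⟩ := x
      induction e with | _ u v => exact he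
    · rintro ⟨c, ⟨e, he⟩⟩ ⟨c', ⟨e', he'⟩⟩ h
      have h1 : e.map Subtype.val = e'.map Subtype.val := congrArg Subtype.val h
      have hc : c = c' := by
        induction e with | _ u v =>
        induction e' with | _ u' v' =>
        have hu : H.connectedComponentMk u.1 = c := u.2
        have hu' : H.connectedComponentMk u'.1 = c' := u'.2
        have hv' : H.connectedComponentMk v'.1 = c' := v'.2
        simp only [Sym2.map_mk, Sym2.eq_iff] at h1
        rcases h1 with ⟨h1, -⟩ | ⟨h1, -⟩
        · rw [← hu, ← hu', h1]
        · rw [← hu, ← hv', h1]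
      subst hc
      have := Sym2.map.injective Subtype.val_injective h1
      subst this
      rfl
  rw [hV]
  calc ∑ c : H.ConnectedComponent, Nat.card c.supp
      ≤ ∑ c : H.ConnectedComponent, (Nat.card c.toSimpleGraph.edgeSet + 1) :=
        Finset.sum_le_sum fun c _ =>
          c.connected_toSimpleGraph.card_vert_le_card_edgeSet_add_one
    _ ≤ _ := by
        rw [Finset.sum_add_distrib]
        simpa using hE

theorem card_edgeSet_deleteEdges_singleton {H : SimpleGraph V} {e : Sym2 V} (he : e ∈ H.edgeSet) :
    Nat.card (H.deleteEdges {e}).edgeSet + 1 = Nat.card H.edgeSet := by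
  rw [edgeSet_deleteEdges]
  simp only [Nat.card_coe_set_eq]
  exact Set.ncard_sdiff_singleton_add_one he

theorem isAcyclic_iff_card_edgeSet_add (H : SimpleGraph V) :
    H.IsAcyclic ↔
      Nat.card H.edgeSet + Nat.card H.ConnectedComponent = Nat.card V := by
  constructor
  · intro hH
    refine le_antisymm ?_ (card_le_card_edgeSet_add_card_connectedComponent H)
    induction hn : Nat.card H.edgeSet generalizing H with
    | zero =>
      rw [zero_add]
      exact Nat.card_le_card_of_surjective H.connectedComponentMk Quot.mk_surjective
    | succ n ih =>
      have : Nonempty H.edgeSet := (Nat.card_pos_iff.1 (by omega)).1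
      obtain ⟨e, he⟩ := this
      have hle : H.deleteEdges {e} ≤ H := deleteEdges_le _
      have h1 := ih (H.deleteEdges {e}) (hH.anti hle)
        (by have := card_edgeSet_deleteEdges_singleton he; omega)
      -- Equal cardinalities would make the surjection between the component sets injective, so the
      -- ends of the deleted bridge would still be connected.
      have hlt : Nat.card H.ConnectedComponent <
          Nat.card (H.deleteEdges {e}).ConnectedComponent := by
        refine lt_of_le_of_ne (ConnectedComponent.card_le_card_of_le hle) fun heq => ?_
        have hinj := ((Nat.bijective_iff_surjective_and_card _).2
          ⟨ConnectedComponent.surjective_map_ofLE hle, heq.symm⟩).1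
        have hb := isAcyclic_iff_forall_isBridge.1 hH he
        induction e with | _ u v =>
        rw [isBridge_iff] at hb
        refine hb (ConnectedComponent.exact (hinj ?_))
        exact ConnectedComponent.sound (Adj.reachable he)
      omega
  · intro h
    rw [isAcyclic_iff_forall_isBridge]
    intro e he
    by_contra hb
    have hle : H.deleteEdges {e} ≤ H := deleteEdges_le _
    -- Deleting an edge that is not a bridge lowers the edge count but not the component count,
    -- which violates the general inequality for the smaller graph.
    have h1 := card_le_card_edgeSet_add_card_connectedComponent (H.deleteEdges {e})
    have h2 := card_edgeSet_deleteEdges_singleton he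
    have h3 : Nat.card (H.deleteEdges {e}).ConnectedComponent ≤
        Nat.card H.ConnectedComponent := by
      refine Nat.card_le_card_of_injective (ConnectedComponent.map (Hom.ofLE hle)) ?_
      intro x y hxy
      induction x using ConnectedComponent.ind with | _ x =>
      induction y using ConnectedComponent.ind with | _ y =>
      have hr : H.Reachable x y := ConnectedComponent.exact hxy
      refine ConnectedComponent.sound ?_
      clear hxy
      obtain ⟨w⟩ := hr
      induction w with
      | nil => exact Reachable.refl _
      | @cons a b c hab _ ih =>
        refine Reachable.trans ?_ ih
        by_cases hab' : s(a, b) = e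
        · subst hab'
          rw [isBridge_iff, not_not] at hb
          exact hb
        · exact Adj.reachable (by rw [deleteEdges_adj]; exact ⟨hab, hab'⟩)
    omega

end Counting

/-! ### Partitions of the three corners. -/

/-- The partitions of the three outmost vertices: all in one block, the vertex `i` separated from
the other two, and all separated. -/
inductive State
  | joined
  | split (i : Fin 3)
  | separate
  deriving DecidableEq, Fintype

/-- Two outmost vertices lie in the same block. -/
def State.rel : State → Fin 3 → Fin 3 → Bool
  | .joined, _, _ => true
  | .split i, a, b => a = b || (a ≠ i && b ≠ i)
  | .separate, a, b => a = b

/-- The number of blocks. -/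
def State.blocks : State → ℕ
  | .joined => 1
  | .split _ => 2
  | .separate => 3

theorem State.rel_injective : ∀ x y : State, (∀ i j, x.rel i j = y.rel i j) → x = y := by
  decide

theorem State.rel_split : ∀ i : Fin 3, (State.split i).rel (i + 1) (i + 2) ∧
    ¬ (State.split i).rel i (i + 1) := by
  decide

theorem State.eq_split : ∀ (x : State) (i : Fin 3), x.rel (i + 1) (i + 2) →
    ¬ x.rel i (i + 1) → x = .split i := by
  decide

theorem State.exists_rel {r : Fin 3 → Fin 3 → Prop} (hr : Equivalence r) :
    ∃ x : State, ∀ i j, r i j ↔ x.rel i j := by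
  have h10 : r 1 0 ↔ r 0 1 := ⟨hr.symm, hr.symm⟩
  have h20 : r 2 0 ↔ r 0 2 := ⟨hr.symm, hr.symm⟩
  have h21 : r 2 1 ↔ r 1 2 := ⟨hr.symm, hr.symm⟩
  by_cases h01 : r 0 1 <;> by_cases h02 : r 0 2
  · have h12 : r 1 2 := hr.trans (hr.symm h01) h02
    exact ⟨.joined, by simp [Fin.forall_fin_succ, State.rel, hr.refl, *]⟩
  · have h12 : ¬ r 1 2 := fun h => h02 (hr.trans h01 h)
    exact ⟨.split 2, by simp [Fin.forall_fin_succ, State.rel, hr.refl, *]⟩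
  · have h12 : ¬ r 1 2 := fun h => h01 (hr.trans h02 (hr.symm h))
    exact ⟨.split 1, by simp [Fin.forall_fin_succ, State.rel, hr.refl, *]⟩
  · by_cases h12 : r 1 2
    · exact ⟨.split 0, by simp [Fin.forall_fin_succ, State.rel, hr.refl, *]⟩
    · exact ⟨.separate, by simp [Fin.forall_fin_succ, State.rel, hr.refl, *]⟩

theorem State.ncard_range {α : Type*} {c : Fin 3 → α} {x : State}
    (h : ∀ i j, c i = c j ↔ x.rel i j) : (Set.range c).ncard = x.blocks := by
  have hr : Set.range c = {c 0, c 1, c 2} := by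
    ext z; simp [Fin.exists_fin_succ, eq_comm]
  rw [hr]
  match x, h with
  | .joined, h =>
    rw [(h 1 0).2 rfl, (h 2 0).2 rfl]; simp [State.blocks]
  | .split i, h =>
    fin_cases i
    · rw [(h 1 2).2 rfl]
      simp only [Set.mem_singleton_iff, Set.insert_eq_of_mem]
      exact Set.ncard_pair (mt (h 0 2).1 (by decide))
    · rw [(h 0 2).2 rfl, Set.insert_comm]
      simp only [Set.mem_singleton_iff, Set.insert_eq_of_mem]
      exact Set.ncard_pair (mt (h 1 2).1 (by decide))
    · rw [(h 0 1).2 rfl]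
      simp only [Set.mem_insert_iff, true_or, Set.insert_eq_of_mem]
      exact Set.ncard_pair (mt (h 1 2).1 (by decide))
  | .separate, h =>
    exact Set.ncard_eq_three.2 ⟨_, _, _, mt (h 0 1).1 (by decide), mt (h 0 2).1 (by decide),
      mt (h 1 2).1 (by decide), rfl⟩

/-! ### Forests with a prescribed partition of the terminals. -/

section HasState

variable {V : Type*} (p : Fin 3 → V) (H : SimpleGraph V)

/-- Every component of `H` contains a terminal. -/
def Covers : Prop := ∀ v, ∃ i, H.Reachable v (p i)

/-- The components of `H` induce the partition `x` of the terminals. -/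
def Induces (x : State) : Prop := ∀ i j, H.Reachable (p i) (p j) ↔ x.rel i j

/-- `H` is a forest each of whose components contains a terminal, and the partition of the
terminals into components is `x`; acyclicity is expressed by counting edges. -/
def HasState (x : State) : Prop :=
  Covers p H ∧ Induces p H x ∧ Nat.card H.edgeSet + x.blocks = Nat.card V

variable {p H}

theorem exists_induces (p : Fin 3 → V) (H : SimpleGraph V) : ∃ x, Induces p H x :=
  State.exists_rel (r := fun i j => H.Reachable (p i) (p j))
    ⟨fun _ => Reachable.refl _, fun h => h.symm, fun h h' => h.trans h'⟩

theorem Induces.unique {x y : State} (hx : Induces p H x) (hy : Induces p H y) : x = y :=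
  State.rel_injective x y fun i j => Bool.eq_iff_iff.2 ((hx i j).symm.trans (hy i j))

theorem Induces.ncard_range {x : State} (hx : Induces p H x) :
    (Set.range fun i => H.connectedComponentMk (p i)).ncard = x.blocks :=
  State.ncard_range fun i j => ConnectedComponent.eq.trans (hx i j)

theorem covers_iff_range : Covers p H ↔
    Set.range (fun i => H.connectedComponentMk (p i)) = Set.univ := by
  rw [Set.range_eq_univ]
  constructor
  · intro h c
    induction c using ConnectedComponent.ind with | _ v =>
    obtain ⟨i, hi⟩ := h v
    exact ⟨i, ConnectedComponent.sound hi.symm⟩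
  · intro h v
    obtain ⟨i, hi⟩ := h (H.connectedComponentMk v)
    exact ⟨i, ConnectedComponent.exact hi.symm⟩

/-- The components containing a terminal number exactly `x.blocks`, so they are all the components
precisely when the totals agree. -/
theorem Induces.covers_iff [Finite V] {x : State} (hx : Induces p H x) :
    Covers p H ↔ Nat.card H.ConnectedComponent = x.blocks := by
  rw [covers_iff_range, ← hx.ncard_range, ← Set.ncard_univ, eq_comm (b := Set.ncard _)]
  exact ⟨fun h => by rw [h], fun h => Set.eq_of_subset_of_ncard_le (Set.subset_univ _) h.ge⟩

theorem hasState_iff [Finite V] {x : State} :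
    HasState p H x ↔ IsForestWith x.blocks H ∧ Induces p H x := by
  rw [HasState, IsForestWith, isAcyclic_iff_card_edgeSet_add]
  constructor
  · rintro ⟨h1, h2, h3⟩
    have := h2.covers_iff.1 h1
    exact ⟨⟨by omega, this⟩, h2⟩
  · rintro ⟨⟨h1, h2⟩, h3⟩
    exact ⟨h3.covers_iff.2 h2, h3, by omega⟩

theorem hasState_joined_iff [Finite V] : HasState p H .joined ↔ H.IsTree := by
  have hN : Nonempty V := ⟨p 0⟩
  rw [hasState_iff, IsForestWith, isTree_iff, and_comm (a := H.Connected), and_assoc]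
  refine and_congr_right fun _ => ⟨fun ⟨h1, h2⟩ => ?_, fun h => ⟨?_, ?_⟩⟩
  · have h := h2.covers_iff.2 h1
    refine (connected_iff _).2 ⟨fun u v => ?_, hN⟩
    obtain ⟨i, hi⟩ := h u
    obtain ⟨j, hj⟩ := h v
    exact hi.trans (((h2 i j).2 rfl).trans hj.symm)
  · have hI : Induces p H .joined := fun i j => ⟨fun _ => rfl, fun _ => h.preconnected _ _⟩
    exact hI.covers_iff.1 fun v => ⟨0, h.preconnected _ _⟩
  · exact fun i j => ⟨fun _ => rfl, fun _ => h.preconnected _ _⟩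

theorem hasState_split_iff [Finite V] {i : Fin 3} : HasState p H (.split i) ↔
    IsForestWith 2 H ∧ H.Reachable (p (i + 1)) (p (i + 2)) ∧
      ¬ H.Reachable (p i) (p (i + 1)) := by
  rw [hasState_iff]
  refine and_congr_right fun _ => ⟨fun h => ⟨(h _ _).2 (State.rel_split i).1,
    mt (h _ _).1 (State.rel_split i).2⟩, fun ⟨h1, h2⟩ => ?_⟩
  obtain ⟨x, hx⟩ := exists_induces p H
  rw [hx] at h1 h2
  exact State.eq_split x i h1 h2 ▸ hx

theorem hasState_separate_iff [Finite V] : HasState p H .separate ↔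
    IsForestWith 3 H ∧ ∀ i j : Fin 3, i ≠ j → ¬ H.Reachable (p i) (p j) := by
  rw [hasState_iff]
  refine and_congr_right fun _ => ⟨fun h i j hij => mt (h _ _).1 (by simpa [State.rel]),
    fun h i j => ?_⟩
  by_cases hij : i = j
  · subst hij; simp [State.rel]
  · simp [h i j hij, State.rel, hij]

end HasState

/-! ### Connectivity of three glued copies, computed from their states. -/

/-- The states `x` of the three copies connect the two corners of the copy `k` at which it is glued
to the other two copies. -/
def link (x : Fin 3 → State) (k : Fin 3) : Bool := (x k).rel (k + 1) (k + 2)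

/-- The component of the junction opposite to the copy `m`, named by its first junction. -/
def midLabel (x : Fin 3 → State) : Fin 3 → Fin 3
  | 0 => 0
  | 1 => if link x 2 || (link x 0 && link x 1) then 0 else 1
  | 2 => if link x 1 || (link x 0 && link x 2) then 0 else if link x 0 then 1 else 2

/-- The component of the corner `i` of the copy `k` when three copies with the states `x` are
glued at the corners: it is named by a junction, or else by the outer corner it consists of. -/
def label (x : Fin 3 → State) (u : Fin 3 × Fin 3) : Fin 3 ⊕ Fin 3 :=
  if u.2 = u.1 then
    if (x u.1).rel u.1 (u.1 + 1) then .inl (midLabel x (u.1 + 2))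
    else if (x u.1).rel u.1 (u.1 + 2) then .inl (midLabel x (u.1 + 1))
    else .inr u.1
  else .inl (midLabel x (-(u.1 + u.2)))

theorem label_swap (x : Fin 3 → State) {k l : Fin 3} (h : k ≠ l) :
    label x (k, l) = label x (l, k) := by
  simp [label, h, h.symm, add_comm]

/-- Together with `label_swap` this shows that labels are constant on glued components; it is a
finite check over all triples of states. The converse is `rel_of_label_eq`. -/
theorem label_eq_of_rel (x : Fin 3 → State) {k i j : Fin 3} (h : (x k).rel i j) :
    label x (k, i) = label x (k, j) := by
  have key : ∀ a b c : State, ∀ k i j : Fin 3, (![a, b, c] k).rel i j →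
      label ![a, b, c] (k, i) = label ![a, b, c] (k, j) := by
    decide +kernel
  have hx : x = ![x 0, x 1, x 2] := by ext i; fin_cases i <;> rfl
  rw [hx] at h ⊢
  exact key _ _ _ _ _ _ h

/-- Equality of labels is the smallest equivalence relation containing the junction identifications
and the relations inside the copies: each corner is connected by these generators to the
representative that its label names. -/
theorem rel_of_label_eq {x : Fin 3 → State} (r : Setoid (Fin 3 × Fin 3))
    (hswap : ∀ k l, k ≠ l → r (k, l) (l, k))
    (hrel : ∀ k i j, (x k).rel i j → r (k, i) (k, j)) {u v : Fin 3 × Fin 3}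
    (h : label x u = label x v) : r u v := by
  -- `mid m` is the junction opposite to the copy `m`, seen as a corner of the copy `m + 1`. Modulo
  -- 3 the index different from distinct `k` and `l` is `-(k + l)`.
  let mid : Fin 3 → Fin 3 × Fin 3 := fun m => (m + 1, m + 2)
  have hmid (k l : Fin 3) (hkl : k ≠ l) : r (k, l) (mid (-(k + l))) := by
    have : (k, l) = mid (-(k + l)) ∨ (l, k) = mid (-(k + l)) := by
      revert k l; decide
    rcases this with h | h
    · rw [← h]
    · rw [← h]; exact hswap _ _ hkl
  have hlink (k : Fin 3) (h : link x k) : r (mid (k + 1)) (mid (k + 2)) := by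
    have h1 := hmid k (k + 2) (by clear * -; revert k; decide)
    have h2 := hmid k (k + 1) (by clear * -; revert k; decide)
    have e1 : -(k + (k + 2)) = k + 1 := by clear * -; revert k; decide
    have e2 : -(k + (k + 1)) = k + 2 := by clear * -; revert k; decide
    rw [e1] at h1
    rw [e2] at h2
    exact r.trans (r.symm h1) (r.trans (r.symm (hrel _ _ _ h)) h2)
  have hml (m : Fin 3) : r (mid m) (mid (midLabel x m)) := by
    have h0 : link x 0 → r (mid 1) (mid 2) := hlink 0
    have h1 : link x 1 → r (mid 2) (mid 0) := hlink 1
    have h2 : link x 2 → r (mid 0) (mid 1) := hlink 2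
    fin_cases m
    · exact r.refl _
    · simp only [Fin.mk_one, midLabel]
      split_ifs with h
      · simp only [Bool.or_eq_true, Bool.and_eq_true] at h
        rcases h with h | ⟨h, h'⟩
        · exact r.symm (h2 h)
        · exact r.trans (h0 h) (h1 h')
      · exact r.refl _
    · simp only [Fin.reduceFinMk, midLabel]
      split_ifs with h h'
      · simp only [Bool.or_eq_true, Bool.and_eq_true] at h
        rcases h with h | ⟨h, h'⟩
        · exact h1 h
        · exact r.symm (r.trans (h2 h') (h0 h))
      · exact r.symm (h0 h')
      · exact r.refl _
  have hlab (u : Fin 3 × Fin 3) : r u (Sum.elim mid (fun k => (k, k)) (label x u)) := by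
    obtain ⟨k, i⟩ := u
    simp only [label]
    split_ifs with h1 h2 h3
    · subst h1
      have h := hmid i (i + 1) (by clear * -; revert i; decide)
      have e : -(i + (i + 1)) = i + 2 := by clear * -; revert i; decide
      rw [e] at h
      exact r.trans (hrel _ _ _ h2) (r.trans h (hml _))
    · subst h1
      have h := hmid i (i + 2) (by clear * -; revert i; decide)
      have e : -(i + (i + 2)) = i + 1 := by clear * -; revert i; decide
      rw [e] at h
      exact r.trans (hrel _ _ _ h3) (r.trans h (hml _))
    · subst h1
      exact r.refl _
    · exact r.trans (hmid k i (Ne.symm h1)) (hml _)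
  exact r.trans (hlab u) (h ▸ r.symm (hlab v))

/-- Gluing three copies with the states `x` leaves every component with an outer corner and
induces the state `y` on the outer corners. -/
def Yields (x : Fin 3 → State) (y : State) : Prop :=
  (∀ u, ∃ o, label x u = label x (o, o)) ∧
    ∀ i j, label x (i, i) = label x (j, j) ↔ y.rel i j

instance (x : Fin 3 → State) (y : State) : Decidable (Yields x y) :=
  inferInstanceAs (Decidable (_ ∧ _))

/-- Gluing three forests with the states `x` gives a forest with the state `y`. -/
def Good (x : Fin 3 → State) (y : State) : Prop :=
  Yields x y ∧ (x 0).blocks + (x 1).blocks + (x 2).blocks = y.blocks + 3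

instance (x : Fin 3 → State) (y : State) : Decidable (Good x y) :=
  inferInstanceAs (Decidable (_ ∧ _))

/-- Each of the three junction identifications merges at most two blocks, so at least the sum of the
block numbers minus 3 classes remain, and each of them contains an outer corner. Equality means that
no cycle runs through the junctions. -/
theorem Yields.blocks_le {x : Fin 3 → State} {y : State} (h : Yields x y) :
    (x 0).blocks + (x 1).blocks + (x 2).blocks ≤ y.blocks + 3 := by
  have key : ∀ a b c y : State, Yields ![a, b, c] y →
      a.blocks + b.blocks + c.blocks ≤ y.blocks + 3 := by
    decide +kernel
  have hx : x = ![x 0, x 1, x 2] := by ext i; fin_cases i <;> rfl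
  rw [hx] at h
  exact key _ _ _ _ h

/-! ### Gluing three graphs along their terminals. -/

/-- The set `W` consists of three copies `f k` of `V`, where the terminal `l` of the copy `k` is
identified with the terminal `k` of the copy `l`, and there are no other identifications. -/
structure IsGluing {V W : Type*} (p : Fin 3 → V) (f : Fin 3 → V ↪ W) : Prop where
  injective : Function.Injective p
  glue : ∀ k l, k ≠ l → f k (p l) = f l (p k)
  eq_of_eq : ∀ k l, k ≠ l → ∀ v w, f k v = f l w → v = p l ∧ w = p k
  surjective : ∀ w, ∃ k v, f k v = w

namespace IsGluing

variable {V W : Type*} {p : Fin 3 → V} {f : Fin 3 → V ↪ W} (hf : IsGluing p f)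
include hf

/-- Inclusion–exclusion: the second copy meets the first in one point, and the third meets their
union in two distinct points. -/
theorem card [Finite V] : Nat.card W + 3 = 3 * Nat.card V := by
  have hr (k) : (Set.range (f k)).ncard = Nat.card V := Set.ncard_range_of_injective (f k).injective
  have hfin (k) : (Set.range (f k)).Finite := Set.finite_range _
  have h01 : Set.range (f 0) ∩ Set.range (f 1) = {f 0 (p 1)} := by
    ext w
    simp only [Set.mem_inter_iff, Set.mem_range, Set.mem_singleton_iff]
    constructor
    · rintro ⟨⟨v, rfl⟩, v', h⟩
      rw [(hf.eq_of_eq 0 1 (by decide) _ _ h.symm).1]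
    · rintro rfl
      exact ⟨⟨_, rfl⟩, _, (hf.glue 0 1 (by decide)).symm⟩
  have h2 : (Set.range (f 0) ∪ Set.range (f 1)) ∩ Set.range (f 2) = {f 0 (p 2), f 1 (p 2)} := by
    ext w
    simp only [Set.mem_inter_iff, Set.mem_union, Set.mem_range, Set.mem_insert_iff,
      Set.mem_singleton_iff]
    constructor
    · rintro ⟨⟨v, rfl⟩ | ⟨v, rfl⟩, v', h⟩
      · rw [(hf.eq_of_eq 0 2 (by decide) _ _ h.symm).1]; exact Or.inl rfl
      · rw [(hf.eq_of_eq 1 2 (by decide) _ _ h.symm).1]; exact Or.inr rfl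
    · rintro (rfl | rfl)
      · exact ⟨Or.inl ⟨_, rfl⟩, _, (hf.glue 0 2 (by decide)).symm⟩
      · exact ⟨Or.inr ⟨_, rfl⟩, _, (hf.glue 1 2 (by decide)).symm⟩
  have huniv : Set.range (f 0) ∪ Set.range (f 1) ∪ Set.range (f 2) = Set.univ := by
    refine Set.eq_univ_of_forall fun w => ?_
    obtain ⟨k, v, rfl⟩ := hf.surjective w
    fin_cases k
    · exact Or.inl (Or.inl ⟨v, rfl⟩)
    · exact Or.inl (Or.inr ⟨v, rfl⟩)
    · exact Or.inr ⟨v, rfl⟩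
  have hne : f 0 (p 2) ≠ f 1 (p 2) := fun h =>
    absurd (hf.injective (hf.eq_of_eq 0 1 (by decide) _ _ h).1) (by decide)
  have e1 := Set.ncard_union_add_ncard_inter _ _ (hfin 0) (hfin 1)
  have e2 := Set.ncard_union_add_ncard_inter _ _ ((hfin 0).union (hfin 1)) (hfin 2)
  rw [h01, Set.ncard_singleton, hr, hr] at e1
  rw [h2, huniv, Set.ncard_univ, Set.ncard_pair hne, hr] at e2
  omega

/-- The terminals of a gluing. -/
theorem eq_of_eq_terminal {k o : Fin 3} {v : V} (h : f k v = f o (p o)) : v = p o := by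
  by_cases hko : k = o
  · subst hko; exact (f k).injective h
  · exact (hf.eq_of_eq _ _ hko _ _ h).1

section Reachable

variable {H : SimpleGraph W} (hH : ∀ u v, H.Adj u v → ∃ k a b, f k a = u ∧ f k b = v)
include hH

/-- A walk can leave a copy only through one of its terminals, and an outer corner lying in the copy
is a terminal of it. So a walk to an outer corner meets a terminal without having left the copy. -/
theorem covers_comap (hc : Covers (fun k => f k (p k)) H) (k : Fin 3) :
    Covers p (H.comap (f k)) := by
  intro v
  by_contra! hv
  have key : ∀ w, H.Reachable (f k v) w → ∃ v', f k v' = w ∧ (H.comap (f k)).Reachable v v' := by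
    intro w hw
    rw [reachable_iff_reflTransGen] at hw
    induction hw with
    | refl => exact ⟨v, rfl, Reachable.refl _⟩
    | tail _ hadj ih =>
      obtain ⟨v', rfl, h⟩ := ih
      obtain ⟨m, a, b, h1, rfl⟩ := hH _ _ hadj
      by_cases hm : m = k
      · subst hm
        obtain rfl := (f m).injective h1
        exact ⟨b, rfl, h.trans (Adj.reachable hadj)⟩
      · obtain ⟨rfl, rfl⟩ := hf.eq_of_eq _ _ hm _ _ h1
        exact absurd h (hv m)
  obtain ⟨o, ho⟩ := hc (f k v)
  obtain ⟨v', h1, h2⟩ := key _ ho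
  exact hv o (hf.eq_of_eq_terminal h1 ▸ h2)

theorem label_eq_of_reachable {x : Fin 3 → State} (hx : ∀ k, Induces p (H.comap (f k)) (x k))
    {k l i j : Fin 3} (h : H.Reachable (f k (p i)) (f l (p j))) :
    label x (k, i) = label x (l, j) := by
  -- A vertex seen from two different copies is their junction, a terminal of both, so the label
  -- carries over through `label_swap`.
  have transfer : ∀ m m' v v', f m v = f m' v' → ∀ a, (H.comap (f m)).Reachable v (p a) →
      ∃ b, (H.comap (f m')).Reachable v' (p b) ∧ label x (m, a) = label x (m', b) := by
    intro m m' v v' hv a ha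
    by_cases hm : m = m'
    · subst hm
      exact ⟨a, (f m).injective hv ▸ ha, rfl⟩
    · obtain ⟨rfl, rfl⟩ := hf.eq_of_eq _ _ hm _ _ hv
      refine ⟨m, Reachable.refl _, ?_⟩
      rw [← label_eq_of_rel x ((hx m _ _).1 ha), label_swap x hm]
  -- Invariant along the walk: each vertex reached is connected, inside some copy, to a corner with
  -- the initial label.
  have key : ∀ w, H.Reachable (f k (p i)) w → ∃ m v a, f m v = w ∧
      (H.comap (f m)).Reachable v (p a) ∧ label x (k, i) = label x (m, a) := by
    intro w hw
    rw [reachable_iff_reflTransGen] at hw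
    induction hw with
    | refl => exact ⟨k, p i, i, rfl, Reachable.refl _, rfl⟩
    | tail _ hadj ih =>
      obtain ⟨m, v, a, rfl, h1, h2⟩ := ih
      obtain ⟨m', v', b, h3, rfl⟩ := hH _ _ hadj
      obtain ⟨a', h4, h5⟩ := transfer m m' v v' h3.symm a h1
      refine ⟨m', b, a', rfl, Reachable.trans (Adj.reachable ?_) h4, h2.trans h5⟩
      rw [comap_adj, h3]
      exact hadj.symm
  obtain ⟨m, v, a, h1, h2, h3⟩ := key _ h
  obtain ⟨b, h4, h5⟩ := transfer m l v (p j) h1 a h2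
  rw [h3, h5, label_eq_of_rel x ((hx l _ _).1 h4)]

theorem reachable_iff_label_eq {x : Fin 3 → State} (hx : ∀ k, Induces p (H.comap (f k)) (x k))
    {k l i j : Fin 3} : H.Reachable (f k (p i)) (f l (p j)) ↔ label x (k, i) = label x (l, j) := by
  refine ⟨hf.label_eq_of_reachable hH hx, fun h => ?_⟩
  exact rel_of_label_eq (u := (k, i)) (v := (l, j))
    (H.reachableSetoid.comap fun u : Fin 3 × Fin 3 => f u.1 (p u.2))
    (fun k l hkl => by rw [Setoid.comap_rel, hf.glue k l hkl])
    (fun k i j hr => ((hx k i j).2 hr).map (Hom.comap (f k) H)) h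

theorem covers_induces_iff {x : Fin 3 → State} (hx : ∀ k, Induces p (H.comap (f k)) (x k))
    (y : State) : Covers (fun k => f k (p k)) H ∧ Induces (fun k => f k (p k)) H y ↔
      (∀ k, Covers p (H.comap (f k))) ∧ Yields x y := by
  have hi : Induces (fun k => f k (p k)) H y ↔
      ∀ i j, label x (i, i) = label x (j, j) ↔ y.rel i j :=
    forall₂_congr fun i j => iff_congr (hf.reachable_iff_label_eq hH hx) Iff.rfl
  rw [Yields, ← and_assoc, hi]
  refine and_congr_left fun _ => ⟨fun hc => ⟨hf.covers_comap hH hc, fun u => ?_⟩,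
    fun ⟨h1, h2⟩ w => ?_⟩
  · obtain ⟨o, ho⟩ := hc (f u.1 (p u.2))
    exact ⟨o, (hf.reachable_iff_label_eq hH hx).1 ho⟩
  · obtain ⟨k, v, rfl⟩ := hf.surjective w
    obtain ⟨i, hi⟩ := h1 k v
    obtain ⟨o, ho⟩ := h2 (k, i)
    exact ⟨o, (hi.map (Hom.comap (f k) H)).trans ((hf.reachable_iff_label_eq hH hx).2 ho)⟩

/-- Distinct copies share at most one vertex, hence no edge. -/
theorem edgeMap_bijective : Function.Bijective
    (fun e : Σ k, (H.comap (f k)).edgeSet =>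
      (⟨e.2.1.map (f e.1), by
        obtain ⟨k, ⟨e, he⟩⟩ := e
        induction e with | _ a b => exact he⟩ : H.edgeSet)) := by
  constructor
  · rintro ⟨k, ⟨e, he⟩⟩ ⟨l, ⟨e', he'⟩⟩ h
    have h1 : e.map (f k) = e'.map (f l) := congrArg Subtype.val h
    have hkl : k = l := by
      by_contra hkl
      induction e with | _ a b =>
      induction e' with | _ a' b' =>
      have hab : a ≠ b := fun h => he.ne (congrArg (f k) h)
      simp only [Sym2.map_mk, Sym2.eq_iff] at h1
      rcases h1 with ⟨h1, h2⟩ | ⟨h1, h2⟩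
      · exact hab ((hf.eq_of_eq k l hkl _ _ h1).1.trans (hf.eq_of_eq k l hkl _ _ h2).1.symm)
      · exact hab ((hf.eq_of_eq k l hkl _ _ h1).1.trans (hf.eq_of_eq k l hkl _ _ h2).1.symm)
    subst hkl
    have := Sym2.map.injective (f k).injective h1
    subst this
    rfl
  · rintro ⟨e, he⟩
    induction e with | _ u v =>
    obtain ⟨k, a, b, rfl, rfl⟩ := hH u v he
    exact ⟨⟨k, s(a, b), he⟩, rfl⟩

theorem card_edgeSet [Finite V] [Finite W] : Nat.card H.edgeSet =
    ∑ k, Nat.card (H.comap (f k)).edgeSet := by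
  rw [← Nat.card_sigma]
  exact (Nat.card_congr (Equiv.ofBijective _ (hf.edgeMap_bijective hH))).symm

/-- Two inequalities squeeze the edge count: the forest bound in each copy and `Yields.blocks_le`.
If the whole is a forest, both are equalities, so the copies are forests and the triple is `Good`.
Conversely, the counts of the copies simply add. -/
theorem hasState_iff_exists [Finite V] [Finite W] (y : State) :
    HasState (fun k => f k (p k)) H y ↔
      ∃ x, Good x y ∧ ∀ k, HasState p (H.comap (f k)) (x k) := by
  have hcV := hf.card
  have hcE := hf.card_edgeSet hH
  rw [Fin.sum_univ_three] at hcE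
  constructor
  · rintro ⟨h1, h2, h3⟩
    choose x hx using fun k => exists_induces p (H.comap (f k))
    obtain ⟨h4, h5⟩ := (hf.covers_induces_iff hH hx y).1 ⟨h1, h2⟩
    -- Summed over the copies: 3|V| ≤ edges + block numbers ≤ edges + `y.blocks` + 3 = |W| + 3 =
    -- 3|V|.
    have hle (k) : Nat.card V ≤ Nat.card (H.comap (f k)).edgeSet + (x k).blocks := by
      rw [← (hx k).covers_iff.1 (h4 k)]
      exact card_le_card_edgeSet_add_card_connectedComponent _
    have hb := h5.blocks_le
    have := hle 0
    have := hle 1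
    have := hle 2
    refine ⟨x, ⟨h5, by omega⟩, fun k => ⟨h4 k, hx k, ?_⟩⟩
    fin_cases k <;> dsimp only [Fin.zero_eta, Fin.mk_one, Fin.reduceFinMk] <;> omega
  · rintro ⟨x, hg, hx⟩
    obtain ⟨h1, h2⟩ := (hf.covers_induces_iff hH (fun k => (hx k).2.1) y).2
      ⟨fun k => (hx k).1, hg.1⟩
    have := (hx 0).2.2
    have := (hx 1).2.2
    have := (hx 2).2.2
    have := hg.2
    exact ⟨h1, h2, by omega⟩

open Classical in
theorem prod_edgeFinset [Fintype V] [Fintype W] {R : Type*} [CommSemiring R]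
    {wV : Fin 3 → Sym2 V → R}
    {wW : Sym2 W → R} (hw : ∀ k, ∀ e ∈ (H.comap (f k)).edgeSet, wW (e.map (f k)) = wV k e) :
    ∏ e ∈ H.edgeFinset, wW e = ∏ k, ∏ e ∈ (H.comap (f k)).edgeFinset, wV k e := by
  have h1 (k) : ∏ e ∈ (H.comap (f k)).edgeFinset, wV k e =
      ∏ e : (H.comap (f k)).edgeSet, wV k e.1 :=
    Finset.prod_subtype _ (fun e => mem_edgeFinset) _
  rw [Finset.prod_congr rfl fun k _ => h1 k, ← Fintype.prod_sigma',
    Finset.prod_subtype (p := (· ∈ H.edgeSet)) _ (fun e => mem_edgeFinset)]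
  refine (Fintype.prod_bijective _ (hf.edgeMap_bijective hH) _ _ ?_).symm
  rintro ⟨k, e, he⟩
  exact (hw k e he).symm

end Reachable

theorem comap_iSup_map (Hs : Fin 3 → SimpleGraph V) (l : Fin 3) :
    (⨆ k, (Hs k).map (f k)).comap (f l) = Hs l := by
  ext a b
  rw [comap_adj, iSup_adj]
  constructor
  · rintro ⟨k, hk⟩
    obtain ⟨a', b', hab, h1, h2⟩ := (map_adj _ _ _ _).1 hk
    by_cases hkl : k = l
    · subst hkl
      rwa [(f k).injective h1, (f k).injective h2] at hab
    · exact absurd ((hf.eq_of_eq _ _ hkl _ _ h1).1.trans (hf.eq_of_eq _ _ hkl _ _ h2).1.symm)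
        hab.ne
  · exact fun h => ⟨l, map_adj_apply.2 h⟩

/-- Restriction to the copies and union of the images are inverse bijections, compatible with
weights and states. The weight may vary with the copy, as the three triangles of the first graph
require. -/
theorem genFun_eq [Fintype V] [Fintype W] {R : Type*} [CommSemiring R]
    {G : SimpleGraph V} {G' : SimpleGraph W}
    (hG : ∀ u v, G'.Adj u v ↔ ∃ k a b, G.Adj a b ∧ f k a = u ∧ f k b = v)
    {wV : Fin 3 → Sym2 V → R} {wW : Sym2 W → R}
    (hw : ∀ k, ∀ e ∈ G.edgeSet, wW (e.map (f k)) = wV k e) (y : State) :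
    genFun G' wW (fun H => HasState (fun k => f k (p k)) H y) =
      ∑ x : Fin 3 → State with Good x y,
        ∏ k, genFun G (wV k) (fun H => HasState p H (x k)) := by
  classical
  have hle {H : SimpleGraph W} (h : H ≤ G') (k) : H.comap (f k) ≤ G := by
    intro a b hab
    obtain ⟨l, a', b', h1, h2, h3⟩ := (hG _ _).1 (h hab)
    by_cases hl : l = k
    · subst hl
      rwa [(f l).injective h2, (f l).injective h3] at h1
    · exact absurd ((hf.eq_of_eq _ _ hl _ _ h2).1.trans (hf.eq_of_eq _ _ hl _ _ h3).1.symm) h1.ne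
  have hadj {H : SimpleGraph W} (h : H ≤ G') :
      ∀ u v, H.Adj u v → ∃ k a b, f k a = u ∧ f k b = v := by
    intro u v huv
    obtain ⟨k, a, b, -, h⟩ := (hG u v).1 (h huv)
    exact ⟨k, a, b, h⟩
  have hsup {Hs : Fin 3 → SimpleGraph V} (h : ∀ k, Hs k ≤ G) : ⨆ k, (Hs k).map (f k) ≤ G' := by
    refine iSup_le fun k u v huv => ?_
    obtain ⟨a, b, hab, h1, h2⟩ := (map_adj _ _ _ _).1 huv
    exact (hG u v).2 ⟨k, a, b, h k hab, h1, h2⟩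
  simp only [genFun, Finset.prod_univ_sum]
  rw [Finset.sum_sigma']
  refine Eq.symm (Finset.sum_bij (fun z _ => ⨆ k, (z.2 k).map (f k)) ?_ ?_ ?_ ?_)
  · rintro ⟨x, Hs⟩ hz
    simp only [Finset.mem_sigma, Finset.mem_filter, Finset.mem_univ, true_and,
      Fintype.mem_piFinset] at hz ⊢
    refine ⟨hsup fun k => (hz.2 k).1, ?_⟩
    rw [hf.hasState_iff_exists (hadj (hsup fun k => (hz.2 k).1))]
    exact ⟨x, hz.1, fun k => by rw [hf.comap_iSup_map]; exact (hz.2 k).2⟩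
  · rintro ⟨x, Hs⟩ hz ⟨x', Hs'⟩ hz' h
    simp only [Finset.mem_sigma, Finset.mem_filter, Finset.mem_univ, true_and,
      Fintype.mem_piFinset] at hz hz'
    have hH : Hs = Hs' := by
      funext k
      rw [← hf.comap_iSup_map Hs k, ← hf.comap_iSup_map Hs' k]
      exact congrArg _ h
    subst hH
    -- The summands for different triples of states do not overlap, since a graph induces only one
    -- partition.
    have hx : x = x' := funext fun k => (hz.2 k).2.2.1.unique (hz'.2 k).2.2.1
    subst hx
    rfl
  · intro H hH
    simp only [Finset.mem_filter, Finset.mem_univ, true_and] at hH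
    obtain ⟨x, hg, hx⟩ := (hf.hasState_iff_exists (hadj hH.1) y).1 hH.2
    refine ⟨⟨x, fun k => H.comap (f k)⟩, ?_, ?_⟩
    · simp only [Finset.mem_sigma, Finset.mem_filter, Finset.mem_univ, true_and,
        Fintype.mem_piFinset]
      exact ⟨hg, fun k => ⟨hle hH.1 k, hx k⟩⟩
    · refine le_antisymm (iSup_le fun k => map_comap_le _ _) fun u v huv => ?_
      obtain ⟨k, a, b, rfl, rfl⟩ := hadj hH.1 u v huv
      rw [iSup_adj]
      exact ⟨k, map_adj_apply.2 huv⟩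
  · rintro ⟨x, Hs⟩ hz
    simp only [Finset.mem_sigma, Finset.mem_filter, Finset.mem_univ, true_and,
      Fintype.mem_piFinset] at hz ⊢
    have h := hsup fun k => (hz.2 k).1
    rw [hf.prod_edgeFinset (hadj h) (wV := wV)
      fun k e he => hw k e (edgeSet_mono (hle h k) he)]
    refine Finset.prod_congr rfl fun k _ => ?_
    exact Finset.prod_congr (by ext; simp only [mem_edgeFinset, hf.comap_iSup_map])
      fun _ _ => rfl

end IsGluing

/-! ### Enumeration of the admissible triples of states. -/

section Sums

variable {R : Type*} [CommSemiring R]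

theorem sum_good_eq (F : Fin 3 → State → R) (y : State) (L : List (State × State × State))
    (hL : L.Nodup) (h : ∀ a b c, (a, b, c) ∈ L ↔ Good ![a, b, c] y) :
    ∑ x : Fin 3 → State with Good x y, ∏ k, F k (x k) =
      (L.map fun t => F 0 t.1 * F 1 t.2.1 * F 2 t.2.2).sum := by
  rw [← List.sum_toFinset _ hL]
  refine Finset.sum_bij' (fun x _ => (x 0, x 1, x 2)) (fun t _ => ![t.1, t.2.1, t.2.2])
    ?_ ?_ ?_ ?_ ?_
  · intro x hx
    have e : ![x 0, x 1, x 2] = x := by ext i; fin_cases i <;> rfl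
    rw [List.mem_toFinset, h, e]
    exact (Finset.mem_filter.1 hx).2
  · rintro ⟨a, b, c⟩ ht
    exact Finset.mem_filter.2 ⟨Finset.mem_univ _, (h a b c).1 (List.mem_toFinset.1 ht)⟩
  · intro x _
    ext i; fin_cases i <;> rfl
  · intro t _; rfl
  · intro x _
    rw [Fin.prod_univ_three]

/-- Two copies are connected and the third breaks the cycle through the junctions. It may split off
either of its junction corners, but not its outer corner, which would be isolated. -/
theorem sum_good_joined (F : Fin 3 → State → R) :
    ∑ x : Fin 3 → State with Good x .joined, ∏ k, F k (x k) =
      F 0 .joined * F 1 .joined * F 2 (.split 0) + F 0 .joined * F 1 .joined * F 2 (.split 1) +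
      F 0 .joined * F 1 (.split 0) * F 2 .joined + F 0 .joined * F 1 (.split 2) * F 2 .joined +
      F 0 (.split 1) * F 1 .joined * F 2 .joined + F 0 (.split 2) * F 1 .joined * F 2 .joined := by
  rw [sum_good_eq F .joined
    [(.joined, .joined, .split 0), (.joined, .joined, .split 1), (.joined, .split 0, .joined),
      (.joined, .split 2, .joined), (.split 1, .joined, .joined), (.split 2, .joined, .joined)]
    (by decide +kernel) (by decide +kernel)]
  simp only [List.map_cons, List.map_nil, List.sum_cons, List.sum_nil]
  ring

theorem sum_good_split (F : Fin 3 → State → R) (i : Fin 3) :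
    ∑ x : Fin 3 → State with Good x (.split i), ∏ k, F k (x k) =
      F i .joined * F (i + 1) (.split i) * F (i + 2) (.split i) +
      F i (.split i) * F (i + 1) .joined * F (i + 2) (.split i) +
      F i (.split i) * F (i + 1) .joined * F (i + 2) (.split (i + 1)) +
      F i (.split i) * F (i + 1) (.split i) * F (i + 2) .joined +
      F i (.split i) * F (i + 1) (.split (i + 2)) * F (i + 2) .joined +
      F i (.split (i + 1)) * F (i + 1) .joined * F (i + 2) (.split i) +
      F i (.split (i + 2)) * F (i + 1) (.split i) * F (i + 2) .joined +
      F i .separate * F (i + 1) .joined * F (i + 2) .joined := by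
  match i with
  | 0 =>
    rw [sum_good_eq F (.split 0)
      [(.split 0, .split 0, .joined), (.split 0, .split 2, .joined),
        (.split 0, .joined, .split 0), (.split 0, .joined, .split 1),
        (.split 1, .joined, .split 0), (.split 2, .split 0, .joined),
        (.joined, .split 0, .split 0), (.separate, .joined, .joined)]
      (by decide +kernel) (by decide +kernel)]
    simp only [List.map_cons, List.map_nil, List.sum_cons, List.sum_nil, Fin.isValue, zero_add]
    ring
  | 1 =>
    rw [sum_good_eq F (.split 1)
      [(.split 1, .split 1, .joined), (.split 1, .split 2, .joined),
        (.split 1, .joined, .split 1), (.split 2, .split 1, .joined),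
        (.joined, .split 0, .split 1), (.joined, .split 1, .split 0),
        (.joined, .split 1, .split 1), (.joined, .separate, .joined)]
      (by decide +kernel) (by decide +kernel)]
    simp only [List.map_cons, List.map_nil, List.sum_cons, List.sum_nil, Fin.isValue,
      Fin.reduceAdd]
    ring
  | 2 =>
    rw [sum_good_eq F (.split 2)
      [(.split 1, .joined, .split 2), (.split 2, .split 2, .joined),
        (.split 2, .joined, .split 1), (.split 2, .joined, .split 2),
        (.joined, .split 0, .split 2), (.joined, .split 2, .split 0),
        (.joined, .split 2, .split 2), (.joined, .joined, .separate)]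
      (by decide +kernel) (by decide +kernel)]
    simp only [List.map_cons, List.map_nil, List.sum_cons, List.sum_nil, Fin.isValue,
      Fin.reduceAdd]
    ring

theorem sum_good_separate (F : Fin 3 → State → R) :
    ∑ x : Fin 3 → State with Good x .separate, ∏ k, F k (x k) =
      F 0 .joined * F 1 (.split 0) * F 2 .separate +
      F 0 .joined * F 1 (.split 1) * F 2 .separate +
      F 0 .joined * F 1 .separate * F 2 (.split 0) +
      F 0 .joined * F 1 .separate * F 2 (.split 2) +
      F 0 (.split 0) * F 1 .joined * F 2 .separate +
      F 0 (.split 0) * F 1 (.split 0) * F 2 (.split 1) +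
      F 0 (.split 0) * F 1 (.split 0) * F 2 (.split 2) +
      F 0 (.split 0) * F 1 (.split 1) * F 2 (.split 0) +
      F 0 (.split 0) * F 1 (.split 1) * F 2 (.split 1) +
      F 0 (.split 0) * F 1 (.split 2) * F 2 (.split 0) +
      F 0 (.split 0) * F 1 (.split 2) * F 2 (.split 2) +
      F 0 (.split 0) * F 1 .separate * F 2 .joined +
      F 0 (.split 1) * F 1 .joined * F 2 .separate +
      F 0 (.split 1) * F 1 (.split 1) * F 2 (.split 0) +
      F 0 (.split 1) * F 1 (.split 1) * F 2 (.split 2) +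
      F 0 (.split 1) * F 1 (.split 2) * F 2 (.split 0) +
      F 0 (.split 1) * F 1 (.split 2) * F 2 (.split 2) +
      F 0 (.split 2) * F 1 (.split 0) * F 2 (.split 1) +
      F 0 (.split 2) * F 1 (.split 0) * F 2 (.split 2) +
      F 0 (.split 2) * F 1 (.split 1) * F 2 (.split 1) +
      F 0 (.split 2) * F 1 (.split 1) * F 2 (.split 2) +
      F 0 (.split 2) * F 1 .separate * F 2 .joined +
      F 0 .separate * F 1 .joined * F 2 (.split 1) +
      F 0 .separate * F 1 .joined * F 2 (.split 2) +
      F 0 .separate * F 1 (.split 1) * F 2 .joined + F 0 .separate * F 1 (.split 2) * F 2 .joined := by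
  rw [sum_good_eq F .separate
    [(.joined, .split 0, .separate), (.joined, .split 1, .separate),
      (.joined, .separate, .split 0), (.joined, .separate, .split 2),
      (.split 0, .joined, .separate), (.split 0, .split 0, .split 1),
      (.split 0, .split 0, .split 2), (.split 0, .split 1, .split 0),
      (.split 0, .split 1, .split 1), (.split 0, .split 2, .split 0),
      (.split 0, .split 2, .split 2), (.split 0, .separate, .joined),
      (.split 1, .joined, .separate), (.split 1, .split 1, .split 0),
      (.split 1, .split 1, .split 2), (.split 1, .split 2, .split 0),
      (.split 1, .split 2, .split 2), (.split 2, .split 0, .split 1),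
      (.split 2, .split 0, .split 2), (.split 2, .split 1, .split 1),
      (.split 2, .split 1, .split 2), (.split 2, .separate, .joined),
      (.separate, .joined, .split 1), (.separate, .joined, .split 2),
      (.separate, .split 1, .joined), (.separate, .split 2, .joined)]
    (by decide +kernel) (by decide +kernel)]
  simp only [List.map_cons, List.map_nil, List.sum_cons, List.sum_nil]
  ring

end Sums

/-! ### Spanning forests of a single triangle. -/

section Triangle

/-- The graph on three vertices in which the edge opposite to `m` is present if `b m` holds. -/
def triangle (b : Fin 3 → Bool) : SimpleGraph (Fin 3) where
  Adj i j := i ≠ j ∧ b (-(i + j))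
  symm := ⟨fun i j h => ⟨h.1.symm, add_comm i j ▸ h.2⟩⟩
  loopless := ⟨fun _ h => h.1 rfl⟩

instance (b : Fin 3 → Bool) : DecidableRel (triangle b).Adj :=
  fun i j => inferInstanceAs (Decidable (i ≠ j ∧ b (-(i + j))))

theorem triangle_adj {b : Fin 3 → Bool} {i j : Fin 3} :
    (triangle b).Adj i j ↔ i ≠ j ∧ b (-(i + j)) := Iff.rfl

theorem triangle_bijective : Function.Bijective triangle := by
  constructor
  · intro b b' h
    have h' (i j : Fin 3) (hij : i ≠ j) : b (-(i + j)) = b' (-(i + j)) := by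
      have := iff_of_eq (congrArg (fun G : SimpleGraph (Fin 3) => G.Adj i j) h)
      exact Bool.eq_iff_iff.2 ⟨fun hb => (this.1 ⟨hij, hb⟩).2, fun hb => (this.2 ⟨hij, hb⟩).2⟩
    funext m
    fin_cases m
    · exact h' 1 2 (by decide)
    · exact h' 0 2 (by decide)
    · exact h' 0 1 (by decide)
  · intro H
    classical
    refine ⟨fun m => decide (H.Adj (m + 1) (m + 2)), ?_⟩
    ext i j
    rw [triangle_adj, decide_eq_true_iff]
    by_cases hij : i = j
    · subst hij; simp
    · have : s(-(i + j) + 1, -(i + j) + 2) = s(i, j) := by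
        clear * - hij; revert i j; decide
      rw [← mem_edgeSet, this, mem_edgeSet]
      simp [hij]

/-- Distinct vertices are joined by their own edge or by the path through the third vertex, whose
edges are those opposite to `i` and `j`. -/
theorem triangle_reachable (b : Fin 3 → Bool) (i j : Fin 3) :
    (triangle b).Reachable i j ↔ i = j ∨ b (-(i + j)) ∨ (b i ∧ b j) := by
  constructor
  · intro h
    rw [reachable_iff_reflTransGen] at h
    induction h with
    | refl => exact Or.inl rfl
    | @tail k l _ h ih =>
      have key : ∀ (b : Fin 3 → Bool) (i k l : Fin 3), (triangle b).Adj k l →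
          (i = k ∨ b (-(i + k)) ∨ (b i ∧ b k)) → (i = l ∨ b (-(i + l)) ∨ (b i ∧ b l)) := by
        decide +kernel
      exact key b i k l h ih
  · by_cases hij : i = j
    · rintro -
      rw [hij]
    · rintro (h | h | ⟨h1, h2⟩)
      · exact absurd h hij
      · exact Adj.reachable ⟨hij, h⟩
      · have key : ∀ i j : Fin 3, i ≠ j → (i ≠ -(i + j) ∧ -(i + -(i + j)) = j) ∧
            (-(i + j) ≠ j ∧ -(-(i + j) + j) = i) := by decide
        obtain ⟨⟨h3, h4⟩, h5, h6⟩ := key i j hij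
        exact (Adj.reachable (G := triangle b) ⟨h3, h4.symm ▸ h2⟩).trans
          (Adj.reachable ⟨h5, h6.symm ▸ h1⟩)

/-- The edge of the triangle opposite to `m`. -/
def oppositeEdge (m : Fin 3) : Sym2 (Fin 3) := s(m + 1, m + 2)

theorem oppositeEdge_injective : Function.Injective oppositeEdge := by decide

theorem mem_edgeSet_triangle (b : Fin 3 → Bool) (e : Sym2 (Fin 3)) :
    e ∈ (triangle b).edgeSet ↔
      e ∈ (Finset.univ.filter fun m => b m).map ⟨oppositeEdge, oppositeEdge_injective⟩ := by
  have key : ∀ (b : Fin 3 → Bool) (i j : Fin 3), (triangle b).Adj i j ↔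
      s(i, j) ∈ (Finset.univ.filter fun m => b m).map ⟨oppositeEdge, oppositeEdge_injective⟩ := by
    decide +kernel
  induction e with | _ i j => exact key b i j

/-- A computable form of `HasState` for the graphs on three vertices. -/
def TriangleState (b : Fin 3 → Bool) (x : State) : Prop :=
  (∀ i j, (i = j ∨ b (-(i + j)) ∨ (b i ∧ b j)) ↔ x.rel i j) ∧
    (Finset.univ.filter fun m => b m).card + x.blocks = 3

instance (b : Fin 3 → Bool) (x : State) : Decidable (TriangleState b x) :=
  inferInstanceAs (Decidable (_ ∧ _))

theorem hasState_triangle (b : Fin 3 → Bool) (x : State) :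
    HasState id (triangle b) x ↔ TriangleState b x := by
  have hcard : Nat.card (triangle b).edgeSet = (Finset.univ.filter fun m => b m).card := by
    rw [Nat.card_coe_set_eq, ← Finset.card_map ⟨oppositeEdge, oppositeEdge_injective⟩,
      ← Set.ncard_coe_finset]
    exact congrArg Set.ncard (Set.ext (mem_edgeSet_triangle b))
  rw [HasState, TriangleState, hcard, Nat.card_fin]
  simp only [Induces, id, triangle_reachable]
  exact and_iff_right fun v => ⟨v, Reachable.refl _⟩

theorem genFun_triangle {R : Type*} [CommSemiring R] (w : Sym2 (Fin 3) → R) (x : State) :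
    genFun ⊤ w (fun H => HasState id H x) =
      ∑ b : Fin 3 → Bool with TriangleState b x,
        ∏ m with b m, w (oppositeEdge m) := by
  classical
  refine Eq.symm (Finset.sum_bij (fun b _ => triangle b) ?_ ?_ ?_ ?_)
  · intro b hb
    simpa [hasState_triangle] using hb
  · intro b _ b' _ h
    exact triangle_bijective.1 h
  · intro H hH
    obtain ⟨b, rfl⟩ := triangle_bijective.2 H
    exact ⟨b, by simpa [hasState_triangle] using hH, rfl⟩
  · intro b _
    symm
    calc _ = ∏ e ∈ (Finset.univ.filter fun m => b m).map
          ⟨oppositeEdge, oppositeEdge_injective⟩, w e :=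
          Finset.prod_congr (by ext e; simp only [mem_edgeFinset, mem_edgeSet_triangle])
            fun _ _ => rfl
      _ = _ := Finset.prod_map _ _ _

theorem genFun_triangle_joined {R : Type*} [CommSemiring R] (w : Sym2 (Fin 3) → R) :
    genFun ⊤ w (fun H => HasState id H .joined) =
      w (oppositeEdge 0) * w (oppositeEdge 1) + w (oppositeEdge 1) * w (oppositeEdge 2) +
        w (oppositeEdge 2) * w (oppositeEdge 0) := by
  have h : (Finset.univ.filter fun b => TriangleState b .joined) =
      {![true, true, false], ![false, true, true], ![true, false, true]} := by decide +kernel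
  rw [genFun_triangle, h, Finset.sum_insert (by decide), Finset.sum_insert (by decide),
    Finset.sum_singleton]
  simp only [Finset.prod_filter, Fin.prod_univ_three]
  simp
  ring

theorem genFun_triangle_split {R : Type*} [CommSemiring R] (w : Sym2 (Fin 3) → R) (i : Fin 3) :
    genFun ⊤ w (fun H => HasState id H (.split i)) = w (oppositeEdge i) := by
  have h : ∀ i, (Finset.univ.filter fun b => TriangleState b (.split i)) =
      {fun m => decide (m = i)} := by decide +kernel
  rw [genFun_triangle, h, Finset.sum_singleton]
  simp [Finset.filter_eq']

theorem genFun_triangle_separate {R : Type*} [CommSemiring R] (w : Sym2 (Fin 3) → R) :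
    genFun ⊤ w (fun H => HasState id H .separate) = 1 := by
  have h : (Finset.univ.filter fun b => TriangleState b .separate) =
      {fun _ => false} := by decide +kernel
  rw [genFun_triangle, h, Finset.sum_singleton]
  simp

end Triangle

/-! ### The Sierpiński graphs as gluings. -/

section Copies

/-- This bound, with nonnegativity of the coordinates, confines each copy to its triangle, so that
distinct copies meet only at a corner. -/
theorem add_le_of_mem_vertices {n : ℕ} {v : ℕ × ℕ} (hv : v ∈ vertices n) : v.1 + v.2 ≤ 2 ^ n := by
  induction n generalizing v with
  | zero => revert v; decide
  | succ n ih =>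
    simp only [vertices, Finset.mem_union, Finset.mem_image] at hv
    rcases hv with (hv | ⟨w, hw, rfl⟩) | ⟨w, hw, rfl⟩
    · have := ih hv; omega
    · have := ih hw; simp only [shift]; omega
    · have := ih hw; simp only [shift]; omega

theorem shift_zero : shift (0, 0) = id := by
  funext v; simp [shift]

theorem mem_vertices_succ {n : ℕ} {w : ℕ × ℕ} :
    w ∈ vertices (n + 1) ↔ ∃ k, ∃ v ∈ vertices n, shift (cornerPoint n k) v = w := by
  simp only [vertices, Finset.mem_union, Finset.mem_image, Fin.exists_fin_succ, cornerPoint,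
    shift_zero, id, exists_eq_right, Fin.succ_zero_eq_one, Fin.succ_one_eq_two,
    IsEmpty.exists_iff, or_false, or_assoc]

theorem mem_edges_succ {n : ℕ} {x : Label} {e : Sym2 (ℕ × ℕ)} :
    e ∈ edges x (n + 2) ↔
      ∃ k, ∃ e' ∈ edges x (n + 1), e'.map (shift (cornerPoint (n + 1) k)) = e := by
  simp only [edges, Finset.mem_union, Finset.mem_image, Fin.exists_fin_succ, cornerPoint,
    shift_zero, Sym2.map_id', id, exists_eq_right, Fin.succ_zero_eq_one, Fin.succ_one_eq_two,
    IsEmpty.exists_iff, or_false, or_assoc]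

theorem mem_vertices_of_mem_edges {n : ℕ} {x : Label} {p q : ℕ × ℕ}
    (h : s(p, q) ∈ edges x (n + 1)) : p ∈ vertices (n + 1) ∧ q ∈ vertices (n + 1) := by
  induction n generalizing p q with
  | zero =>
    have key : ∀ e ∈ edges x 1, e ∈ (vertices 1).sym2 := by
      cases x <;> decide +kernel
    exact Finset.mk_mem_sym2_iff.1 (key _ h)
  | succ n ih =>
    obtain ⟨k, e, he, h⟩ := mem_edges_succ.1 h
    induction e with | _ u v =>
    obtain ⟨hu, hv⟩ := ih he
    simp only [mem_vertices_succ (n := n + 1)]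
    rw [Sym2.map_mk, Sym2.eq_iff] at h
    rcases h with ⟨h1, h2⟩ | ⟨h1, h2⟩
    · exact ⟨⟨k, u, hu, h1⟩, ⟨k, v, hv, h2⟩⟩
    · exact ⟨⟨k, v, hv, h2⟩, ⟨k, u, hu, h1⟩⟩

theorem shift_injective (d : ℕ × ℕ) : Function.Injective (shift d) := by
  intro v w h
  simp only [shift, Prod.ext_iff] at h
  exact Prod.ext (by omega) (by omega)

/-- The inclusion of the `k`-th copy of the preceding graph. -/
def copy (n : ℕ) (k : Fin 3) : Vert n ↪ Vert (n + 1) where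
  toFun v := ⟨shift (cornerPoint n k) v.1, mem_vertices_succ.2 ⟨k, v.1, v.2, rfl⟩⟩
  inj' _ _ h := Subtype.ext (shift_injective _ (congrArg Subtype.val h))

theorem corner_succ (n : ℕ) (k : Fin 3) : corner (n + 1) k = copy n k (corner n k) := by
  refine Subtype.ext ?_
  fin_cases k <;> simp [corner, copy, cornerPoint, shift, pow_succ, mul_two]

theorem isGluing_copy (n : ℕ) : IsGluing (corner n) (copy n) where
  injective i j h := by
    have hpos := Nat.two_pow_pos n
    replace h : cornerPoint n i = cornerPoint n j := congrArg Subtype.val h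
    rw [Prod.ext_iff] at h
    fin_cases i <;> fin_cases j <;> first | rfl | (dsimp [cornerPoint] at h; omega)
  glue k l _ := Subtype.ext (Prod.ext (add_comm _ _) (add_comm _ _))
  eq_of_eq k l hkl v w h := by
    obtain ⟨⟨v1, v2⟩, hv⟩ := v
    obtain ⟨⟨w1, w2⟩, hw⟩ := w
    have hv' := add_le_of_mem_vertices hv
    have hw' := add_le_of_mem_vertices hw
    replace h := congrArg Subtype.val h
    simp only [copy, Function.Embedding.coeFn_mk, shift, Prod.mk.injEq] at h hv' hw'
    simp only [corner, Subtype.mk.injEq]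
    fin_cases k <;> fin_cases l <;> simp [cornerPoint] at h hkl ⊢ <;> omega
  surjective w := by
    obtain ⟨k, v, hv, h⟩ := mem_vertices_succ.1 w.2
    exact ⟨k, ⟨v, hv⟩, Subtype.ext h⟩

theorem graph_adj {n : ℕ} {u v : Vert n} :
    (graph n).Adj u v ↔ (∃ x, s(u.1, v.1) ∈ edges x n) ∧ u ≠ v :=
  fromEdgeSet_adj _

/-- An edge from another copy cannot coincide with this one, since its two distinct ends would both
be the single common vertex. So copying neither adds nor changes labels. -/
theorem mem_edges_copy {n : ℕ} {x : Label} {k : Fin 3} {u v : Vert (n + 1)} (huv : u ≠ v) :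
    s((copy (n + 1) k u).1, (copy (n + 1) k v).1) ∈ edges x (n + 2) ↔
      s(u.1, v.1) ∈ edges x (n + 1) := by
  rw [mem_edges_succ]
  constructor
  · rintro ⟨l, e, he, h⟩
    induction e with | _ p q =>
    obtain ⟨hp, hq⟩ := mem_vertices_of_mem_edges he
    have hf := isGluing_copy (n + 1)
    by_cases hlk : l = k
    · subst hlk
      have : s(p, q).map (shift (cornerPoint (n + 1) l)) =
        s(u.1, v.1).map (shift (cornerPoint (n + 1) l)) := h
      rwa [← Sym2.map.injective (shift_injective _) this]
    · rw [Sym2.map_mk, Sym2.eq_iff] at h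
      refine absurd ?_ huv
      rcases h with ⟨h1, h2⟩ | ⟨h1, h2⟩
      · have h1 : copy _ l ⟨p, hp⟩ = copy _ k u := Subtype.ext h1
        have h2 : copy _ l ⟨q, hq⟩ = copy _ k v := Subtype.ext h2
        exact (hf.eq_of_eq _ _ hlk _ _ h1).2.trans (hf.eq_of_eq _ _ hlk _ _ h2).2.symm
      · have h1 : copy _ l ⟨p, hp⟩ = copy _ k v := Subtype.ext h1
        have h2 : copy _ l ⟨q, hq⟩ = copy _ k u := Subtype.ext h2
        exact (hf.eq_of_eq _ _ hlk _ _ h2).2.trans (hf.eq_of_eq _ _ hlk _ _ h1).2.symm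
  · exact fun h => ⟨k, _, h, rfl⟩

theorem graph_succ_adj {n : ℕ} (u v : Vert (n + 2)) : (graph (n + 2)).Adj u v ↔
    ∃ k a b, (graph (n + 1)).Adj a b ∧ copy (n + 1) k a = u ∧ copy (n + 1) k b = v := by
  simp only [graph_adj]
  constructor
  · rintro ⟨⟨x, hx⟩, huv⟩
    obtain ⟨k, e, he, h⟩ := mem_edges_succ.1 hx
    induction e with | _ p q =>
    obtain ⟨hp, hq⟩ := mem_vertices_of_mem_edges he
    rw [Sym2.map_mk, Sym2.eq_iff] at h
    rcases h with ⟨h1, h2⟩ | ⟨h1, h2⟩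
    · refine ⟨k, ⟨p, hp⟩, ⟨q, hq⟩, ⟨⟨x, he⟩, ?_⟩, Subtype.ext h1, Subtype.ext h2⟩
      rintro h
      obtain rfl := congrArg Subtype.val h
      exact huv (Subtype.ext (h1.symm.trans h2))
    · refine ⟨k, ⟨q, hq⟩, ⟨p, hp⟩, ⟨⟨x, Sym2.eq_swap ▸ he⟩, ?_⟩, Subtype.ext h2, Subtype.ext h1⟩
      rintro h
      obtain rfl := congrArg Subtype.val h
      exact huv (Subtype.ext (h2.symm.trans h1))
  · rintro ⟨k, a, b, ⟨⟨x, hx⟩, hab⟩, rfl, rfl⟩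
    exact ⟨⟨x, (mem_edges_copy hab).2 hx⟩, (copy _ k).injective.ne hab⟩

theorem edgeWeight_copy {R : Type*} (a b c : R) {n : ℕ} (k : Fin 3) {e : Sym2 (Vert (n + 1))}
    (he : e ∈ (graph (n + 1)).edgeSet) :
    edgeWeight a b c (n + 2) (e.map (copy (n + 1) k)) = edgeWeight a b c (n + 1) e := by
  induction e with | _ u v =>
  have huv : u ≠ v := Adj.ne ((mem_edgeSet _).1 he)
  exact if_congr (mem_edges_copy huv) rfl (if_congr (mem_edges_copy huv) rfl rfl)

variable {R : Type*} [CommSemiring R] (a b c : R)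

/-- The weighted generating function of the spanning forests of the `n`-th graph with a given
state. -/
noncomputable def stateSum (n : ℕ) (x : State) : R :=
  genFun (graph n) (edgeWeight a b c n) fun H => HasState (corner n) H x

theorem stateSum_succ (n : ℕ) (y : State) : stateSum a b c (n + 2) y =
    ∑ x : Fin 3 → State with Good x y, ∏ k, stateSum a b c (n + 1) (x k) := by
  have hc : corner (n + 2) = fun k => copy (n + 1) k (corner (n + 1) k) :=
    funext (corner_succ (n + 1))
  rw [stateSum, hc]
  exact (isGluing_copy (n + 1)).genFun_eq graph_succ_adj
    (fun k e he => edgeWeight_copy a b c k he) y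

theorem T_eq_stateSum (n : ℕ) : T a b c n = stateSum a b c n .joined := by
  simp only [T, stateSum, hasState_joined_iff]

theorem S_eq_stateSum (i : Fin 3) (n : ℕ) : S a b c i n = stateSum a b c n (.split i) := by
  simp only [S, stateSum, hasState_split_iff]

theorem Q_eq_stateSum (n : ℕ) : Q a b c n = stateSum a b c n .separate := by
  simp only [Q, stateSum, hasState_separate_iff]

end Copies

/-! ### Initial values and the recursion. -/

section Base

/-- When every vertex is a terminal, the copies can be indexed by `Fin 3`. This presents the first
graph as three glued complete triangles, in place of the level-0 graph, which has no edges. -/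
theorem IsGluing.of_bijective {V W : Type*} {p : Fin 3 → V} {f : Fin 3 → V ↪ W}
    (hf : IsGluing p f) (hp : Function.Bijective p) :
    IsGluing id fun k => (⟨p, hf.injective⟩ : Fin 3 ↪ V).trans (f k) where
  injective := Function.injective_id
  glue := hf.glue
  eq_of_eq k l hkl v w h :=
    have := hf.eq_of_eq k l hkl _ _ h
    ⟨hp.1 this.1, hp.1 this.2⟩
  surjective w := by
    obtain ⟨k, v, rfl⟩ := hf.surjective w
    obtain ⟨i, rfl⟩ := hp.2 v
    exact ⟨k, i, rfl⟩

theorem corner_zero_bijective : Function.Bijective (corner 0) := by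
  decide +kernel

/-- The `k`-th triangle of the first graph. -/
def baseCopy (k : Fin 3) : Fin 3 ↪ Vert 1 :=
  (⟨corner 0, (isGluing_copy 0).injective⟩ : Fin 3 ↪ Vert 0).trans (copy 0 k)

theorem isGluing_baseCopy : IsGluing id baseCopy :=
  (isGluing_copy 0).of_bijective corner_zero_bijective

theorem exists_label {P : Label → Prop} : (∃ x, P x) ↔ P .a ∨ P .b ∨ P .c :=
  ⟨fun ⟨x, hx⟩ => by cases x <;> simp [hx],
    fun h => by rcases h with h | h | h <;> exact ⟨_, h⟩⟩

theorem graph_one_adj (u v : Vert 1) : (graph 1).Adj u v ↔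
    ∃ k i j, (⊤ : SimpleGraph (Fin 3)).Adj i j ∧ baseCopy k i = u ∧ baseCopy k j = v := by
  rw [graph_adj, exists_label]
  simp only [top_adj]
  revert u v
  decide +kernel

/-- In each small triangle the edge opposite to the outer corner joins midpoints and carries `c`;
`a` and `b` follow the rotation of the boundary. -/
theorem edgeWeight_baseCopy {R : Type*} (a b c : R) (k m : Fin 3) :
    edgeWeight a b c 1 ((oppositeEdge m).map (baseCopy k)) =
      if m = k + 2 then a else if m = k + 1 then b else c := by
  have ha : ∀ k m : Fin 3, ((oppositeEdge m).map (baseCopy k)).map Subtype.val ∈ edges .a 1 ↔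
      m = k + 2 := by decide +kernel
  have hb : ∀ k m : Fin 3, ((oppositeEdge m).map (baseCopy k)).map Subtype.val ∈ edges .b 1 ↔
      m = k + 1 := by decide +kernel
  simp only [edgeWeight, ha, hb]

variable {R : Type*} [CommSemiring R] (a b c : R)

/-- The generating function of the forests of the `k`-th triangle of the first graph. -/
noncomputable def baseSum (k : Fin 3) (x : State) : R :=
  genFun ⊤ (fun e => edgeWeight a b c 1 (e.map (baseCopy k))) fun H => HasState id H x

theorem stateSum_one (y : State) : stateSum a b c 1 y =
    ∑ x : Fin 3 → State with Good x y, ∏ k, baseSum a b c k (x k) := by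
  have hc : corner 1 = fun k => baseCopy k (id k) := funext (corner_succ 0)
  rw [stateSum, hc]
  exact isGluing_baseCopy.genFun_eq graph_one_adj (fun k e _ => rfl) y

theorem baseSum_joined (k : Fin 3) : baseSum a b c k .joined = a * b + a * c + b * c := by
  rw [baseSum, genFun_triangle_joined]
  simp only [edgeWeight_baseCopy]
  fin_cases k <;> simp <;> ring

theorem baseSum_split (k i : Fin 3) : baseSum a b c k (.split i) =
    if i = k + 2 then a else if i = k + 1 then b else c := by
  rw [baseSum, genFun_triangle_split, edgeWeight_baseCopy]

theorem baseSum_separate (k : Fin 3) : baseSum a b c k .separate = 1 := by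
  rw [baseSum, genFun_triangle_separate]

theorem stateSum_one_joined : stateSum a b c 1 .joined =
    3 * (a + b) * (a * b + a * c + b * c) ^ 2 := by
  rw [stateSum_one, sum_good_joined]
  simp only [baseSum_joined, baseSum_split]
  simp
  ring

theorem stateSum_one_split (i : Fin 3) : stateSum a b c 1 (.split i) =
    (a + b) * (a + b + 3 * c) * (a * b + a * c + b * c) := by
  rw [stateSum_one, sum_good_split]
  simp only [baseSum_joined, baseSum_split, baseSum_separate]
  fin_cases i <;> simp <;> ring

theorem stateSum_one_separate : stateSum a b c 1 .separate =
    (a + b) * (a + b + 3 * c) ^ 2 := by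
  rw [stateSum_one, sum_good_separate]
  simp only [baseSum_joined, baseSum_split, baseSum_separate]
  simp
  ring

theorem stateSum_succ_of_eq {n : ℕ} {s : R} (h : ∀ i, stateSum a b c (n + 1) (.split i) = s) :
    stateSum a b c (n + 2) .joined = 6 * stateSum a b c (n + 1) .joined ^ 2 * s ∧
    (∀ i, stateSum a b c (n + 2) (.split i) = 7 * stateSum a b c (n + 1) .joined * s ^ 2 +
      stateSum a b c (n + 1) .joined ^ 2 * stateSum a b c (n + 1) .separate) ∧
    stateSum a b c (n + 2) .separate =
      12 * stateSum a b c (n + 1) .joined * s * stateSum a b c (n + 1) .separate +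
        14 * s ^ 3 := by
  refine ⟨?_, fun i => ?_, ?_⟩
  · rw [stateSum_succ, sum_good_joined fun _ => stateSum a b c (n + 1)]
    simp only [h]
    ring
  · rw [stateSum_succ, sum_good_split fun _ => stateSum a b c (n + 1)]
    simp only [h]
    ring
  · rw [stateSum_succ, sum_good_separate fun _ => stateSum a b c (n + 1)]
    simp only [h]
    ring

/-- The recursion requires equal split sums at one level and returns a value free of `i` at the
next, so independence propagates from the explicit first level. -/
theorem stateSum_split_eq (n : ℕ) (i j : Fin 3) :
    stateSum a b c (n + 1) (.split i) = stateSum a b c (n + 1) (.split j) := by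
  induction n generalizing i j with
  | zero => rw [stateSum_one_split, stateSum_one_split]
  | succ n ih =>
    have h := (stateSum_succ_of_eq a b c fun k => ih k i).2.1
    rw [h, h]

end Base

end SierpinskiTrees

theorem mainTheorem8 {R : Type*} [CommSemiring R] (a b c : R) :
    (∀ n : ℕ, 1 ≤ n → ∀ i j : Fin 3,
      SierpinskiTrees.S a b c i n = SierpinskiTrees.S a b c j n) ∧
    (∀ n : ℕ, 1 ≤ n → ∀ i : Fin 3,
      SierpinskiTrees.T a b c (n + 1) =
        6 * SierpinskiTrees.T a b c n ^ 2 * SierpinskiTrees.S a b c i n ∧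
      SierpinskiTrees.S a b c i (n + 1) =
        7 * SierpinskiTrees.T a b c n * SierpinskiTrees.S a b c i n ^ 2 +
          SierpinskiTrees.T a b c n ^ 2 * SierpinskiTrees.Q a b c n ∧
      SierpinskiTrees.Q a b c (n + 1) =
        12 * SierpinskiTrees.T a b c n * SierpinskiTrees.S a b c i n * SierpinskiTrees.Q a b c n +
          14 * SierpinskiTrees.S a b c i n ^ 3) ∧
    SierpinskiTrees.T a b c 1 = 3 * (a + b) * (a * b + a * c + b * c) ^ 2 ∧
    (∀ i : Fin 3, SierpinskiTrees.S a b c i 1 =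
      (a + b) * (a + b + 3 * c) * (a * b + a * c + b * c)) ∧
    SierpinskiTrees.Q a b c 1 = (a + b) * (a + b + 3 * c) ^ 2 := by
  simp only [SierpinskiTrees.T_eq_stateSum, SierpinskiTrees.S_eq_stateSum,
    SierpinskiTrees.Q_eq_stateSum]
  refine ⟨fun n hn i j => ?_, fun n hn i => ?_, SierpinskiTrees.stateSum_one_joined a b c,
    SierpinskiTrees.stateSum_one_split a b c, SierpinskiTrees.stateSum_one_separate a b c⟩
  · obtain ⟨n, rfl⟩ := Nat.exists_eq_add_of_le' hn
    exact SierpinskiTrees.stateSum_split_eq a b c n i j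
  · obtain ⟨n, rfl⟩ := Nat.exists_eq_add_of_le' hn
    have h := SierpinskiTrees.stateSum_succ_of_eq a b c
      fun k => SierpinskiTrees.stateSum_split_eq a b c n k i
    exact ⟨h.1, h.2.1 i, h.2.2⟩
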